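/- Setting. For a positive semidefinite matrix $W\in\mathbb{R}^{d\times d}$ put $d_W(x,y)=\sqrt{(x-y)^{\top}W(x-y)}$. Let $X\subset\mathbb{R}^d$ be a set of $n$ points, partitioned into $k$ non-empty clusters $\mathcal{C}=\{C_1,\dots,C_k\}$ (the latent clustering). A cluster $C\in\mathcal{C}$ has margin $\gamma>0$ if there are a positive semidefinite matrix $W$ and a point $c\in\mathbb{R}^d$ (both may depend on $C$) such that $d_W(y,c)>\sqrt{1+\gamma}\,d_W(x,c)$ for all $x\in C$ and all $y\in X\setminus C$; $\mathcal{C}$ has margin $\gamma$ if all its clusters do. A randomized learning algorithm receives $(X,k,\gamma)$ and adaptively makes same-cluster queries, each of which names two points of $X$ and is answered by whether they lie in the same cluster of $\mathcal{C}$; if it halts, it returns a clustering $\hat{\mathcal{C}}=\{\hat C_1,\dots,\hat C_k\}$ of $X$ (some $\hat C_i$ may be empty). Its error is $\triangle(\hat{\mathcal{C}},\mathcal{C})=\min_{\sigma}\frac{1}{2n}\sum_{i=1}^{k}|C_i\,\triangle\,\hat C_{\sigma(i)}|$, the minimum being over all permutations $\sigma$ of $\{1,\dots,k\}$. Theorem.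 There are absolute constants $c_1,c_2>0$ such that for every randomized learning algorithm the following holds. (1) For all $0<\gamma<1/7$ and all integers $d\ge 2$ there is a set $X\subset\mathbb{R}^d$ of $n\ge 2\left(\frac{1+\gamma}{8\gamma}\right)^{\frac{d-1}{2}}$ points with a latent clustering $\mathcal{C}$ of $X$ into $3$ non-empty clusters such that $\mathcal{C}$ has margin $\gamma$ and, if on this instance the algorithm returns with probability at least $2/3$ a clustering $\hat{\mathcal{C}}$ with $\triangle(\hat{\mathcal{C}},\mathcal{C})=0$, then it makes at least $c_1 n$ same-cluster queries in expectation on it. (2) For all $\gamma>0$ and all integers $d\ge 48(1+\gamma)^2$ there is a set $X\subset\mathbb{R}^d$ of $n\ge c_2\,e^{d/(48(1+\gamma)^2)}$ points with a latent clustering $\mathcal{C}$ of $X$ into $2$ non-empty clusters such that $\mathcal{C}$ has margin $\gamma$ and, if on this instance the algorithm returns with probability at least $2/3$ a clustering $\hat{\mathcal{C}}$ with $\triangle(\hat{\mathcal{C}},\mathcal{C})=0$, then it makes at least $c_1 n$ same-cluster queries in expectation on it. -/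

import Mathlib

open scoped ENNReal Matrix
open MeasureTheory

noncomputable section

namespace SCQ

/-- The seminorm `√(xᵀ W x)` induced on `ℝ^d` by a positive semidefinite matrix `W`. -/
def normW {d : ℕ} (W : Matrix (Fin d) (Fin d) ℝ) (x : Fin d → ℝ) : ℝ :=
  √(x ⬝ᵥ (W *ᵥ x))

/-- The pseudometric induced on `ℝ^d` by a positive semidefinite matrix `W`. -/
def distW {d : ℕ} (W : Matrix (Fin d) (Fin d) ℝ) (x y : Fin d → ℝ) : ℝ :=
  normW W (x - y)

/-- A division of the finite point set `X` into `k` labelled (possibly empty) clusters. -/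
abbrev Clustering {d : ℕ} (X : Finset (Fin d → ℝ)) (k : ℕ) : Type :=
  X → Fin k

/-- The `i`-th cluster. -/
def cluster {d : ℕ} {X : Finset (Fin d → ℝ)} {k : ℕ} (C : Clustering X k) (i : Fin k) :
    Finset X :=
  Finset.univ.filter fun x => C x = i

/-- A cluster `S ⊆ X` has margin `γ`: for some positive semidefinite `W` and some centre `c`,
`d_W(y, c) > √(1 + γ) d_W(x, c)` for all `x ∈ S` and all points `y ∈ X` outside `S`. -/
def ClusterHasMargin {d : ℕ} {X : Finset (Fin d → ℝ)} (S : Finset X) (γ : ℝ) : Prop :=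
  ∃ W : Matrix (Fin d) (Fin d) ℝ, W.PosSemidef ∧ ∃ c : Fin d → ℝ,
    ∀ y : X, y ∉ S → ∀ x : X, x ∈ S →
      distW W (y : Fin d → ℝ) c > √(1 + γ) * distW W (x : Fin d → ℝ) c

/-- A clustering has margin `γ` if each of its clusters does (with its own `W` and `c`). -/
def HasMargin {d : ℕ} {X : Finset (Fin d → ℝ)} {k : ℕ} (C : Clustering X k) (γ : ℝ) : Prop :=
  ∀ i, ClusterHasMargin (cluster C i) γ

/-- The disagreement of two clusterings under the best relabelling of the clusters. -/
def disagreement {d : ℕ} {X : Finset (Fin d → ℝ)} {k : ℕ} (C' C : Clustering X k) : ℝ :=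
  ⨅ σ : Equiv.Perm (Fin k),
    1 / (2 * (X.card : ℝ)) * ∑ i, ((symmDiff (cluster C i) (cluster C' (σ i))).card : ℝ)

/-- A deterministic adaptive algorithm on the point set `X`: given the list of the answers
received so far (most recent first), it either asks a same-cluster query or halts and returns
a clustering. -/
abbrev Strategy {d : ℕ} (X : Finset (Fin d → ℝ)) (k : ℕ) : Type :=
  List Bool → (X × X) ⊕ Clustering X k

/-- The answer of the same-cluster oracle of the latent clustering `C`. -/
def scq {d : ℕ} {X : Finset (Fin d → ℝ)} {k : ℕ} (C : Clustering X k) (q : X × X) : Bool :=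
  decide (C q.1 = C q.2)

/-- The answers received within the first `t` steps when running `S` against the oracle of `C`;
once `S` has halted nothing changes any more. -/
def transcript {d : ℕ} {X : Finset (Fin d → ℝ)} {k : ℕ} (S : Strategy X k)
    (C : Clustering X k) : ℕ → List Bool
  | 0 => []
  | t + 1 =>
    match S (transcript S C t) with
    | Sum.inl q => scq C q :: transcript S C t
    | Sum.inr _ => transcript S C t

/-- The total number of queries asked by `S` against the oracle of `C` (`∞` if it never halts). -/
def numQueries {d : ℕ} {X : Finset (Fin d → ℝ)} {k : ℕ} (S : Strategy X k)
    (C : Clustering X k) : ℝ≥0∞ :=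
  ⨆ t, ((transcript S C t).length : ℝ≥0∞)

/-- Run against the oracle of `C`, the algorithm `S` halts and returns `C'`. -/
def Returns {d : ℕ} {X : Finset (Fin d → ℝ)} {k : ℕ} (S : Strategy X k)
    (C C' : Clustering X k) : Prop :=
  ∃ t, S (transcript S C t) = Sum.inr C'

/-- A randomized learning algorithm with source of randomness `Ω`: on every input `(X, k, γ)`,
in every dimension `d`, and every random seed `ω`, it is a deterministic adaptive algorithm, and
its next action is a random variable. -/
structure RandomizedAlgorithm (Ω : Type*) [MeasurableSpace Ω] where
  strategy : (d : ℕ) → (X : Finset (Fin d → ℝ)) → (k : ℕ) → (γ : ℝ) → Ω → Strategy X k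
  measurableSet_action : ∀ (d : ℕ) (X : Finset (Fin d → ℝ)) (k : ℕ) (γ : ℝ) (h : List Bool)
    (a : (X × X) ⊕ Clustering X k), MeasurableSet {ω | strategy d X k γ ω h = a}

/-- The probability that the algorithm, on input `(X, k, γ)` with latent clustering `C`, returns
a clustering with zero disagreement. -/
def successProb {Ω : Type*} [MeasurableSpace Ω] (P : Measure Ω) (A : RandomizedAlgorithm Ω)
    {d : ℕ} {X : Finset (Fin d → ℝ)} {k : ℕ} (γ : ℝ) (C : Clustering X k) : ℝ≥0∞ :=
  P {ω | ∃ C', Returns (A.strategy d X k γ ω) C C' ∧ disagreement C' C = 0}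

/-- The expected number of same-cluster queries that the algorithm makes on input `(X, k, γ)`
with latent clustering `C`. -/
def expectedQueries {Ω : Type*} [MeasurableSpace Ω] (P : Measure Ω) (A : RandomizedAlgorithm Ω)
    {d : ℕ} {X : Finset (Fin d → ℝ)} {k : ℕ} (γ : ℝ) (C : Clustering X k) : ℝ≥0∞ :=
  ∫⁻ ω, numQueries (A.strategy d X k γ ω) C ∂P

end SCQ

end

/-! Hide one point. Let all candidate points share a cluster, except an unknown `x` that forms a
cluster of its own. A query avoiding `x` is answered as if nothing were hidden, so a run against the
unperturbed clustering `C₀` already decides which candidates can be found: `M` queries touch at most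
`2M` points, and the output fits at most one further candidate. With `M` about `n / 8`, averaging
gives an `x` found this way with probability at most `7/12`; success `2/3` then forces more than `M`
queries with probability at least `1/12` (`exists_expectedQueries_ge`).

It remains to find many points such that every choice of `x` leaves margin `γ`. Singletons have
every margin. For the big cluster a rank-one `W` suffices, its balls being slabs: some slab must
hold all the other points and miss `x` by the factor `√(1 + γ)`. For two clusters, nearly orthogonal
sign vectors work, with `x` itself as normal. For three clusters, a separated set in a ball is
lifted to a paraboloid, where the tangent hyperplane at `x` bounds a slab; a distant apex is the
third cluster. Greedy packing supplies both point sets. -/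

namespace SCQ

/-! ### Runs of a deterministic strategy against two oracles -/

section Deterministic

variable {d : ℕ} {X : Finset (Fin d → ℝ)} {k : ℕ}

/-- The action of `S` at time `t` when run against the oracle of `C`. -/
def action (S : Strategy X k) (C : Clustering X k) (t : ℕ) : (X × X) ⊕ Clustering X k :=
  S (transcript S C t)

theorem transcript_succ_of_query {S : Strategy X k} {C : Clustering X k} {t : ℕ} {q : X × X}
    (h : action S C t = Sum.inl q) :
    transcript S C (t + 1) = scq C q :: transcript S C t := by
  unfold action at h
  rw [transcript, h]

theorem transcript_succ_of_halt {S : Strategy X k} {C D : Clustering X k} {t : ℕ}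
    (h : action S C t = Sum.inr D) : transcript S C (t + 1) = transcript S C t := by
  unfold action at h
  rw [transcript, h]

theorem action_of_halt {S : Strategy X k} {C D : Clustering X k} {t s : ℕ}
    (h : action S C t = Sum.inr D) (hts : t ≤ s) : action S C s = Sum.inr D := by
  induction s, hts using Nat.le_induction with
  | base => exact h
  | succ s _ ih => rw [action, transcript_succ_of_halt ih]; exact ih

theorem action_halt_unique {S : Strategy X k} {C D D' : Clustering X k} {t s : ℕ}
    (h : action S C t = Sum.inr D) (h' : action S C s = Sum.inr D') : D = D' := by
  have h1 := action_of_halt h (le_max_left t s)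
  have h2 := action_of_halt h' (le_max_right t s)
  exact Sum.inr_injective (h1.symm.trans h2)

theorem length_transcript {S : Strategy X k} {C : Clustering X k} {t : ℕ}
    (h : ∀ s < t, ∃ q, action S C s = Sum.inl q) : (transcript S C t).length = t := by
  induction t with
  | zero => rfl
  | succ t ih =>
    obtain ⟨q, hq⟩ := h t t.lt_succ_self
    rw [transcript_succ_of_query hq, List.length_cons, ih fun s hs => h s (hs.trans t.lt_succ_self)]

/-- Equal answers keep the two runs in the same state, so the next query is again the same; only the
queries of the run against `C` need checking. -/
theorem transcript_congr {S : Strategy X k} {C C' : Clustering X k} {t : ℕ}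
    (h : ∀ s < t, ∀ q, action S C s = Sum.inl q → scq C' q = scq C q) :
    transcript S C' t = transcript S C t := by
  induction t with
  | zero => rfl
  | succ t ih =>
    have ht := ih fun s hs => h s (hs.trans t.lt_succ_self)
    cases hS : action S C t with
    | inl q =>
      have hS' : action S C' t = Sum.inl q := by rw [action, ht]; exact hS
      rw [transcript_succ_of_query hS, transcript_succ_of_query hS', ht,
        h t t.lt_succ_self q hS]
    | inr D =>
      have hS' : action S C' t = Sum.inr D := by rw [action, ht]; exact hS
      rw [transcript_succ_of_halt hS, transcript_succ_of_halt hS', ht]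

/-- If `S` returns `D` against `C'`, while `C` and `C'` answer alike the queries that `S` asks
against `C` before time `M`, then either `S` returns `D` against `C` up to time `M`, or it asks more
than `M` queries against `C'`. -/
theorem halts_or_le_numQueries {S : Strategy X k} {C C' D : Clustering X k} {M : ℕ}
    (h : ∀ s < M, ∀ q, action S C s = Sum.inl q → scq C' q = scq C q)
    (hD : Returns S C' D) :
    (∃ t ≤ M, action S C t = Sum.inr D) ∨ ((M + 1 : ℕ) : ℝ≥0∞) ≤ numQueries S C' := by
  have hact : ∀ t ≤ M, action S C' t = action S C t := fun t ht => by
    rw [action, action, transcript_congr fun s hs => h s (hs.trans_le ht)]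
  by_cases hq : ∀ t ≤ M, ∃ q, action S C t = Sum.inl q
  · right
    have hlen : (transcript S C' (M + 1)).length = M + 1 := length_transcript fun s hs => by
      rw [hact s (Nat.lt_succ_iff.mp hs)]
      exact hq s (Nat.lt_succ_iff.mp hs)
    calc ((M + 1 : ℕ) : ℝ≥0∞) = ((transcript S C' (M + 1)).length : ℝ≥0∞) := by rw [hlen]
      _ ≤ numQueries S C' := le_iSup (fun t => ((transcript S C' t).length : ℝ≥0∞)) (M + 1)
  · left
    push Not at hq
    obtain ⟨t, ht, hne⟩ := hq
    cases hS : action S C t with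
    | inl q => exact absurd hS (hne q)
    | inr E =>
      obtain ⟨s, hs⟩ := hD
      have hE : E = D := action_halt_unique ((hact t ht).trans hS) hs
      exact ⟨t, ht, hE ▸ hS⟩

theorem exists_perm_of_disagreement_eq_zero {C' C : Clustering X k}
    (h : disagreement C' C = 0) : ∃ σ : Equiv.Perm (Fin k), ∀ x, C' x = σ (C x) := by
  obtain ⟨σ, hσ⟩ := exists_eq_ciInf_of_finite (f := fun σ : Equiv.Perm (Fin k) =>
    1 / (2 * (X.card : ℝ)) * ∑ i, ((symmDiff (cluster C i) (cluster C' (σ i))).card : ℝ))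
  refine ⟨σ, fun x => ?_⟩
  -- The point `x` makes `X` non-empty. For empty `X` the prefactor would be `1 / 0 = 0` and zero
  -- disagreement would say nothing.
  have hX : 0 < (X.card : ℝ) := by
    exact_mod_cast Finset.card_pos.mpr ⟨x.1, x.2⟩
  have h0 := hσ.trans h
  simp only [mul_eq_zero] at h0
  have h1 := h0.resolve_left (by positivity)
  rw [Finset.sum_eq_zero_iff_of_nonneg fun _ _ => Nat.cast_nonneg _] at h1
  have h2 := h1 (C x) (Finset.mem_univ _)
  rw [Nat.cast_eq_zero, Finset.card_eq_zero, ← Finset.bot_eq_empty, symmDiff_eq_bot] at h2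
  have h3 : x ∈ cluster C (C x) := by simp [cluster]
  rw [h2] at h3
  simpa [cluster] using h3

theorem scq_eq_of_disagreement_eq_zero {C' C : Clustering X k}
    (h : disagreement C' C = 0) (q : X × X) : scq C q = scq C' q := by
  obtain ⟨σ, hσ⟩ := exists_perm_of_disagreement_eq_zero h
  simp [scq, hσ]

end Deterministic

/-! ### Measurability, averaging and the query lower bound -/

section Randomized

variable {Ω : Type*} [MeasurableSpace Ω] {d : ℕ} {X : Finset (Fin d → ℝ)} {k : ℕ}

/-- Histories and actions range over countable types, so the event splits into countably many pieces
according to the previous history and the action taken there. -/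
theorem measurableSet_transcript (A : RandomizedAlgorithm Ω) (γ : ℝ) (C : Clustering X k)
    (t : ℕ) (l : List Bool) :
    MeasurableSet {ω | transcript (A.strategy d X k γ ω) C t = l} := by
  induction t generalizing l with
  | zero => simp [transcript]
  | succ t ih =>
    have : {ω | transcript (A.strategy d X k γ ω) C (t + 1) = l} =
        ⋃ l' : List Bool, ⋃ a : (X × X) ⊕ Clustering X k,
          ({ω | transcript (A.strategy d X k γ ω) C t = l'} ∩
            {ω | A.strategy d X k γ ω l' = a}) ∩
            {_ω | Sum.elim (fun q => scq C q :: l') (fun _ => l') a = l} := by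
      ext ω
      simp only [Set.mem_ofPred_eq, Set.mem_iUnion, Set.mem_inter_iff, and_assoc,
        transcript]
      split <;> rename_i h <;> simp [h]
    rw [this]
    exact MeasurableSet.iUnion fun l' => MeasurableSet.iUnion fun a =>
      ((ih l').inter (A.measurableSet_action d X k γ l' a)).inter (MeasurableSet.const _)

theorem measurableSet_action_eq (A : RandomizedAlgorithm Ω) (γ : ℝ) (C : Clustering X k)
    (t : ℕ) (a : (X × X) ⊕ Clustering X k) :
    MeasurableSet {ω | action (A.strategy d X k γ ω) C t = a} := by
  have : {ω | action (A.strategy d X k γ ω) C t = a} =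
      ⋃ l : List Bool, {ω | transcript (A.strategy d X k γ ω) C t = l} ∩
        {ω | A.strategy d X k γ ω l = a} := by
    ext ω
    simp [action]
  rw [this]
  exact MeasurableSet.iUnion fun l =>
    (measurableSet_transcript A γ C t l).inter (A.measurableSet_action d X k γ l a)

theorem measurable_numQueries (A : RandomizedAlgorithm Ω) (γ : ℝ) (C : Clustering X k) :
    Measurable fun ω => numQueries (A.strategy d X k γ ω) C := by
  refine Measurable.iSup fun t => ?_
  let _ : MeasurableSpace (List Bool) := ⊤
  have h : Measurable fun ω => transcript (A.strategy d X k γ ω) C t :=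
    measurable_to_countable' fun l => measurableSet_transcript A γ C t l
  have h' : Measurable fun l : List Bool => ((l.length : ℕ) : ℝ≥0∞) := fun _ _ => trivial
  exact h'.comp h

/-- Averaging: if no seed lies in more than `b` of the measurable sets `B i`, `i ∈ Y`, then some
`B i` has probability at most `b / #Y`. -/
theorem exists_card_mul_measure_le {ι : Type*} (P : Measure Ω) [IsProbabilityMeasure P]
    (Y : Finset ι) (hY : Y.Nonempty) (B : ι → Set Ω) (hB : ∀ i, MeasurableSet (B i)) (b : ℕ)
    (hcard : ∀ ω, ∃ Z : Finset ι, Z.card ≤ b ∧ ∀ i ∈ Y, ω ∈ B i → i ∈ Z) :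
    ∃ i ∈ Y, (Y.card : ℝ≥0∞) * P (B i) ≤ b := by
  classical
  obtain ⟨i, hi, hmin⟩ := Y.exists_min_image (fun i => P (B i)) hY
  refine ⟨i, hi, ?_⟩
  calc (Y.card : ℝ≥0∞) * P (B i) = ∑ _j ∈ Y, P (B i) := by simp
    _ ≤ ∑ j ∈ Y, P (B j) := Finset.sum_le_sum hmin
    _ = ∑ j ∈ Y, ∫⁻ ω, (B j).indicator 1 ω ∂P := by
      simp only [lintegral_indicator_one (hB _)]
    _ = ∫⁻ ω, ∑ j ∈ Y, (B j).indicator 1 ω ∂P :=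
      (lintegral_finsetSum _ fun j _ => measurable_one.indicator (hB j)).symm
    _ ≤ ∫⁻ _ω, (b : ℝ≥0∞) ∂P := by
      refine lintegral_mono fun ω => ?_
      simp only [Set.indicator_apply, Pi.one_apply, Finset.sum_boole]
      obtain ⟨Z, hZ, hBZ⟩ := hcard ω
      refine Nat.cast_le.mpr (le_trans (Finset.card_le_card fun i hi => ?_) hZ)
      obtain ⟨hiY, hiB⟩ := Finset.mem_filter.mp hi
      exact hBZ i hiY hiB
    _ = b := by simp

/-- Finding a hidden point: if the latent clustering arises from `C₀` by moving an unknown point of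
`Y` from its cluster `l` to an unused cluster `j`, then a linear number of queries is necessary. -/
theorem exists_expectedQueries_ge (P : Measure Ω) [IsProbabilityMeasure P]
    (A : RandomizedAlgorithm Ω) (γ : ℝ) (C₀ : Clustering X k) (Y : Finset X) (l j : Fin k)
    (hlj : l ≠ j) (hC₀ : ∀ y ∈ Y, C₀ y = l) (hY : 3 ≤ Y.card) :
    ∃ x ∈ Y, (2 / 3 ≤ successProb P A γ (Function.update C₀ x j) →
      ENNReal.ofReal (1 / 96 * (Y.card : ℝ)) ≤
        expectedQueries P A γ (Function.update C₀ x j)) := by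
  classical
  obtain ⟨M, hM1, hM2⟩ : ∃ M : ℕ, Y.card ≤ 8 * (M + 1) ∧ 8 * M < Y.card :=
    ⟨(Y.card - 1) / 8, by omega, by omega⟩
  set act : Ω → ℕ → (X × X) ⊕ Clustering X k := fun ω => action (A.strategy d X k γ ω) C₀
  have hscq : ∀ (x : X) (q : X × X), q.1 ≠ x → q.2 ≠ x →
      scq (Function.update C₀ x j) q = scq C₀ q := fun x q h1 h2 => by
    simp [scq, h1, h2]
  -- "`x` is found", in terms of the run against `C₀`, which does not depend on `x`. Queries at
  -- times below `M` count, and so does an output at time `M` after them: hence `M` and `M + 1`.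
  set B : X → Set Ω := fun x =>
    {ω | (∃ t ∈ Finset.range M, ∃ q, act ω t = Sum.inl q ∧ (q.1 = x ∨ q.2 = x)) ∨
      ∃ t ∈ Finset.range (M + 1), ∃ D, act ω t = Sum.inr D ∧
        disagreement D (Function.update C₀ x j) = 0} with hBdef
  have hBmeas : ∀ x, MeasurableSet (B x) := fun x => by
    have hact : ∀ t a, MeasurableSet {ω | act ω t = a} :=
      fun t a => measurableSet_action_eq A γ C₀ t a
    have : B x = (⋃ t ∈ Finset.range M, ⋃ q : X × X,
        {ω | act ω t = Sum.inl q} ∩ {_ω | q.1 = x ∨ q.2 = x}) ∪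
        ⋃ t ∈ Finset.range (M + 1), ⋃ D : Clustering X k,
          {ω | act ω t = Sum.inr D} ∩
            {_ω | disagreement D (Function.update C₀ x j) = 0} := by
      ext ω
      simp [hBdef]
    rw [this]
    exact (Finset.measurableSet_biUnion _ fun t _ => MeasurableSet.iUnion fun q =>
      (hact t _).inter (MeasurableSet.const _)).union
      (Finset.measurableSet_biUnion _ fun t _ => MeasurableSet.iUnion fun D =>
        (hact t _).inter (MeasurableSet.const _))
  have hBcard : ∀ ω, ∃ Z : Finset X, Z.card ≤ 2 * M + 1 ∧ ∀ x ∈ Y, ω ∈ B x → x ∈ Z := fun ω => by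
    set T : Finset X := (Finset.range M).biUnion fun t =>
      Sum.elim (fun q => {q.1, q.2}) (fun _ => ∅) (act ω t) with hTdef
    set R : Set X := {x | ∃ t ∈ Finset.range (M + 1), ∃ D,
      act ω t = Sum.inr D ∧ disagreement D (Function.update C₀ x j) = 0}
    set U : Finset X := Y.filter (· ∈ R)
    have hsub : ∀ x ∈ Y, ω ∈ B x → x ∈ T ∪ U := by
      intro x hxY hx
      rcases hx with ⟨t, ht, q, hq, hqx⟩ | hx
      · refine Finset.mem_union_left _ (Finset.mem_biUnion.mpr ⟨t, ht, ?_⟩)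
        rw [hq]
        rcases hqx with rfl | rfl <;> simp
      · exact Finset.mem_union_right _ (Finset.mem_filter.mpr ⟨hxY, hx⟩)
    have hT : T.card ≤ 2 * M := by
      have := Finset.card_biUnion_le_card_mul (Finset.range M) (fun t =>
        Sum.elim (fun q : X × X => ({q.1, q.2} : Finset X)) (fun _ => ∅) (act ω t)) 2
        fun t _ => by
          cases act ω t with
          | inl q => exact Finset.card_le_two
          | inr D => simp
      rw [Finset.card_range, ← hTdef] at this
      omega
    have hU : U.card ≤ 1 := by
      refine Finset.card_le_one.mpr fun x hx y hy => ?_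
      obtain ⟨hxY, t, -, D, hD, hDx⟩ := Finset.mem_filter.mp hx
      obtain ⟨hyY, s, -, D', hD', hDy⟩ := Finset.mem_filter.mp hy
      obtain rfl : D = D' := action_halt_unique hD hD'
      by_contra hxy
      -- A third candidate `z` tells the two hypotheses apart: `y` and `z` are together if `x` is
      -- hidden, apart if `y` is. This is where `3 ≤ Y.card` enters.
      obtain ⟨z, hz, hzn⟩ : ∃ z ∈ Y, z ∉ ({x, y} : Finset X) := by
        refine Finset.exists_mem_notMem_of_card_lt_card (lt_of_le_of_lt Finset.card_le_two ?_)
        omega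
      simp only [Finset.mem_insert, Finset.mem_singleton, not_or] at hzn
      have := (scq_eq_of_disagreement_eq_zero hDx (y, z)).trans
        (scq_eq_of_disagreement_eq_zero hDy (y, z)).symm
      simp [scq, hzn.1, hzn.2, Ne.symm hxy, hC₀ y hyY, hC₀ z hz, hlj.symm] at this
    exact ⟨T ∪ U, (Finset.card_union_le _ _).trans (by omega), hsub⟩
  obtain ⟨x, hxY, hx⟩ := exists_card_mul_measure_le P Y
    (Finset.card_pos.mp (by omega)) B hBmeas _ hBcard
  refine ⟨x, hxY, fun hsucc => ?_⟩
  set N : Ω → ℝ≥0∞ := fun ω => numQueries (A.strategy d X k γ ω) (Function.update C₀ x j)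
  have hsub : {ω | ∃ C', Returns (A.strategy d X k γ ω) (Function.update C₀ x j) C' ∧
      disagreement C' (Function.update C₀ x j) = 0} ⊆
        B x ∪ {ω | ((M + 1 : ℕ) : ℝ≥0∞) ≤ N ω} := by
    rintro ω ⟨D, hret, hD⟩
    by_cases htouch : ∃ t ∈ Finset.range M, ∃ q, act ω t = Sum.inl q ∧ (q.1 = x ∨ q.2 = x)
    · exact Or.inl (Or.inl htouch)
    · push Not at htouch
      rcases halts_or_le_numQueries (C := C₀) (M := M) (fun s hs q hq =>
        hscq x q (htouch s (Finset.mem_range.mpr hs) q hq).1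
          (htouch s (Finset.mem_range.mpr hs) q hq).2) hret with ⟨t, ht, h⟩ | h
      · exact Or.inl (Or.inr ⟨t, Finset.mem_range.mpr (Nat.lt_succ_of_le ht), D, h, hD⟩)
      · exact Or.inr h
  have hprob : 2 / 3 ≤ P (B x) + P {ω | ((M + 1 : ℕ) : ℝ≥0∞) ≤ N ω} :=
    (hsucc.trans (measure_mono hsub)).trans (measure_union_le _ _)
  have hmarkov : ((M + 1 : ℕ) : ℝ≥0∞) * P {ω | ((M + 1 : ℕ) : ℝ≥0∞) ≤ N ω} ≤
      expectedQueries P A γ (Function.update C₀ x j) :=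
    mul_meas_ge_le_lintegral (measurable_numQueries A γ _) _
  refine le_trans ?_ hmarkov
  clear hmarkov
  have hp : P (B x) ≠ ∞ := measure_ne_top _ _
  have hr : P {ω | ((M + 1 : ℕ) : ℝ≥0∞) ≤ N ω} ≠ ∞ := measure_ne_top _ _
  generalize P (B x) = p at hp hx hprob
  generalize P {ω | ((M + 1 : ℕ) : ℝ≥0∞) ≤ N ω} = r at hr hprob ⊢
  lift p to NNReal using hp
  lift r to NNReal using hr
  have hx' : (Y.card : ℝ) * p ≤ 2 * M + 1 := by exact_mod_cast hx
  have hprob' : (2 / 3 : ℝ) ≤ p + r := by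
    have : ((2 / 3 : NNReal) : ℝ≥0∞) ≤ ((p + r : NNReal) : ℝ≥0∞) := by
      push_cast
      exact hprob
    have := ENNReal.coe_le_coe.mp this
    have := NNReal.coe_le_coe.mpr this
    push_cast at this
    exact this
  have hn3 : (3 : ℝ) ≤ Y.card := by exact_mod_cast hY
  have hn1 : (Y.card : ℝ) ≤ 8 * (M + 1) := by exact_mod_cast hM1
  have hn2 : (8 : ℝ) * M + 1 ≤ Y.card := by exact_mod_cast hM2
  -- From `8M + 1 ≤ n` and `3 ≤ n`, in fact `(2M + 1) / n ≤ 1/4 + 3/(4n) ≤ 1/2`.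
  have hp' : (p : ℝ) ≤ 7 / 12 := by nlinarith
  have hr' : (1 / 12 : ℝ) ≤ r := by linarith
  refine ENNReal.ofReal_le_of_le_toReal ?_
  simp only [ENNReal.toReal_mul, ENNReal.toReal_natCast, ENNReal.coe_toReal]
  push_cast
  nlinarith

end Randomized

end SCQ

namespace SCQ

/-! ### Margins from slabs and singletons -/

section Margin

variable {d : ℕ}

theorem distW_vecMulVec (v x y : Fin d → ℝ) :
    distW (Matrix.vecMulVec v v) x y = |v ⬝ᵥ (x - y)| := by
  have h : (x - y) ⬝ᵥ (Matrix.vecMulVec v v *ᵥ (x - y)) = (v ⬝ᵥ (x - y)) ^ 2 := by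
    rw [Matrix.vecMulVec_mulVec, op_smul_eq_smul, dotProduct_smul, dotProduct_comm (x - y),
      smul_eq_mul, sq]
  rw [distW, normW, h, Real.sqrt_sq_eq_abs]

theorem clusterHasMargin_of_dotProduct {X : Finset (Fin d → ℝ)} {S : Finset X} {γ : ℝ}
    (v c : Fin d → ℝ)
    (h : ∀ y : X, y ∉ S → ∀ x : X, x ∈ S →
      √(1 + γ) * |v ⬝ᵥ ((x : Fin d → ℝ) - c)| < |v ⬝ᵥ ((y : Fin d → ℝ) - c)|) :
    ClusterHasMargin S γ := by
  refine ⟨Matrix.vecMulVec v v, ?_, c, fun y hy x hx => ?_⟩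
  · simpa using Matrix.posSemidef_vecMulVec_self_star v
  · rw [distW_vecMulVec, distW_vecMulVec]
    exact h y hy x hx

/-- Centred at `p` the inner distance is `0`, so no factor matters; the Euclidean metric separates
the rest. -/
theorem clusterHasMargin_of_subset_singleton {X : Finset (Fin d → ℝ)} {S : Finset X} (γ : ℝ)
    (p : X) (h : ∀ x ∈ S, x = p) (hp : p ∈ S) : ClusterHasMargin S γ := by
  refine ⟨1, Matrix.PosSemidef.one, p, fun y hy x hx => ?_⟩
  obtain rfl := h x hx
  have h0 : distW 1 (x : Fin d → ℝ) x = 0 := by simp [distW, normW]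
  rw [h0, mul_zero, gt_iff_lt, distW, normW, Real.sqrt_pos, Matrix.one_mulVec]
  have hne : (y : Fin d → ℝ) - x ≠ 0 := sub_ne_zero.mpr fun e => hy (Subtype.ext e ▸ hp)
  exact lt_of_le_of_ne (Finset.sum_nonneg fun i _ => mul_self_nonneg _)
    (Ne.symm (mt dotProduct_self_eq_zero.mp hne))

end Margin

/-! ### Packing by measure -/

section Greedy

/-- Greedy packing: if the points unrelated to any given point of `K` have measure at most `ε`, then
`K` contains `n` pairwise related points as soon as `(n - 1) ε` is below the measure of `K`. -/
theorem exists_finset_pairwise {α : Type*} [MeasurableSpace α] (μ : Measure α)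
    (K : Set α) (r : α → α → Prop) (hsymm : ∀ x y, r x y → r y x) (hirr : ∀ x, ¬ r x x) (ε : ℝ≥0∞)
    (hε : ∀ x ∈ K, μ {y | ¬ r x y} ≤ ε) (n : ℕ) (hn : ∀ m < n, m * ε < μ K) :
    ∃ Y : Finset α, Y.card = n ∧ (∀ x ∈ Y, x ∈ K) ∧ ∀ x ∈ Y, ∀ y ∈ Y, x ≠ y → r x y := by
  classical
  induction n with
  | zero => exact ⟨∅, by simp⟩
  | succ n ih =>
    obtain ⟨Y, hcard, hYK, hY⟩ := ih fun m hm => hn m (hm.trans n.lt_succ_self)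
    have hlt : μ (⋃ x ∈ Y, {y | ¬ r x y}) < μ K := by
      calc μ (⋃ x ∈ Y, {y | ¬ r x y}) ≤ ∑ x ∈ Y, μ {y | ¬ r x y} := measure_biUnion_finset_le _ _
        _ ≤ ∑ _x ∈ Y, ε := Finset.sum_le_sum fun x hx => hε x (hYK x hx)
        _ = n * ε := by simp [hcard]
        _ < μ K := hn n n.lt_succ_self
    obtain ⟨z, hzK, hz⟩ : ∃ z ∈ K, z ∉ ⋃ x ∈ Y, {y | ¬ r x y} := by
      by_contra! hcon
      exact absurd (measure_mono hcon) (not_le.mpr hlt)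
    simp only [Set.mem_iUnion, Set.mem_ofPred_eq, exists_prop, not_exists, not_and, not_not] at hz
    have hzY : z ∉ Y := fun h => hirr z (hz z h)
    refine ⟨insert z Y, by rw [Finset.card_insert_of_notMem hzY, hcard], ?_, ?_⟩
    · simpa [hzK] using hYK
    · intro x hx y hy hxy
      rcases Finset.mem_insert.mp hx with rfl | hx' <;>
        rcases Finset.mem_insert.mp hy with rfl | hy'
      · exact absurd rfl hxy
      · exact hsymm _ _ (hz y hy')
      · exact hz x hx'
      · exact hY x hx' y hy' hxy

/-- Each chosen point excludes a unit ball, a fraction `R ^ (-m)` of the volume of the ball of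
radius `R`. -/
theorem exists_separated_ball (m : ℕ) {R : ℝ} (hR : 0 < R) :
    ∃ Y : Finset (EuclideanSpace ℝ (Fin m)), Y.card = ⌈R ^ m⌉₊ ∧ (∀ x ∈ Y, ‖x‖ ≤ R) ∧
      ∀ x ∈ Y, ∀ y ∈ Y, x ≠ y → 1 ≤ ‖x - y‖ := by
  have hpos := Metric.measure_ball_pos volume (0 : EuclideanSpace ℝ (Fin m)) one_pos
  have hfin : volume (Metric.ball (0 : EuclideanSpace ℝ (Fin m)) 1) ≠ ∞ :=
    measure_ball_lt_top.ne
  obtain ⟨Y, h1, h2, h3⟩ := exists_finset_pairwise (α := EuclideanSpace ℝ (Fin m)) volume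
    (Metric.ball 0 R) (fun x y => 1 ≤ ‖x - y‖) (fun x y h => by rwa [norm_sub_rev]) (by simp)
    (volume (Metric.ball (0 : EuclideanSpace ℝ (Fin m)) 1)) (fun x _ => by
      rw [← Measure.addHaar_ball_center volume x]
      refine measure_mono fun y hy => ?_
      simpa [dist_eq_norm, norm_sub_rev] using hy) ⌈R ^ m⌉₊ fun k hk => by
    rw [Measure.addHaar_ball_of_pos volume _ hR, finrank_euclideanSpace_fin]
    refine ENNReal.mul_lt_mul_left hpos.ne' hfin ?_
    rw [← ENNReal.ofReal_natCast]
    exact (ENNReal.ofReal_lt_ofReal_iff (by positivity)).mpr (Nat.lt_ceil.mp hk)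
  exact ⟨Y, h1, fun x hx => (mem_ball_zero_iff.mp (h2 x hx)).le, h3⟩

end Greedy

/-! ### Nearly orthogonal sign vectors -/

section Signs

variable {d : ℕ}

/-- The sign vector in `{-1, 1}^d` encoded by `b`. -/
def signVec (b : Fin d → Bool) : Fin d → ℝ := fun i => if b i then 1 else -1

theorem signVec_injective : Function.Injective (signVec (d := d)) := by
  intro b b' h
  funext i
  have := congrFun h i
  by_cases h1 : b i <;> by_cases h2 : b' i <;> simp_all [signVec] <;> norm_num at this

theorem signVec_dotProduct_self (b : Fin d → Bool) : signVec b ⬝ᵥ signVec b = d := by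
  have : ∀ i, signVec b i * signVec b i = 1 := fun i => by
    by_cases h : b i <;> simp [signVec, h]
  simp [dotProduct, this]

/-- The sum factors over coordinates, each contributing `exp t + exp (-t)` whatever the sign of `b
i`. -/
theorem sum_exp_signVec (b : Fin d → Bool) (t : ℝ) :
    ∑ b' : Fin d → Bool, Real.exp (t * (signVec b ⬝ᵥ signVec b')) = (2 * Real.cosh t) ^ d := by
  have h : ∀ b' : Fin d → Bool, Real.exp (t * (signVec b ⬝ᵥ signVec b')) =
      ∏ i, Real.exp (t * (signVec b i * (if b' i then 1 else -1))) := fun b' => by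
    rw [← Real.exp_sum, dotProduct, Finset.mul_sum]
    rfl
  simp_rw [h]
  rw [← Fintype.prod_sum fun i (c : Bool) => Real.exp (t * (signVec b i * (if c then 1 else -1)))]
  rw [Finset.prod_congr rfl (g := fun _ => 2 * Real.cosh t), Finset.prod_const, Finset.card_univ,
    Fintype.card_fin]
  intro i _
  rw [Real.cosh_eq]
  by_cases hb : b i <;> simp [signVec, hb] <;> ring

/-- Chernoff bound for the number of sign vectors strongly correlated with a given one. -/
theorem card_le_abs_dotProduct_le (b : Fin d → Bool) {s : ℝ} (hs : 0 ≤ s) :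
    ((Finset.univ.filter fun b' : Fin d → Bool => s * d ≤ |signVec b ⬝ᵥ signVec b'|).card : ℝ) ≤
      2 * (2 ^ d * Real.exp (-(s ^ 2 * d / 2))) := by
  -- Exponential Markov with parameter `s`, the minimiser of `t ^ 2 * d / 2 - t * s * d` over `t`;
  -- the two tails give the factor `2`.
  have key : (Finset.univ.filter fun b' : Fin d → Bool =>
      s * d ≤ |signVec b ⬝ᵥ signVec b'|).card * Real.exp (s * (s * d)) ≤
      2 * (2 * Real.cosh s) ^ d := by
    calc (Finset.univ.filter fun b' : Fin d → Bool =>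
          s * d ≤ |signVec b ⬝ᵥ signVec b'|).card * Real.exp (s * (s * d))
        = ∑ _b' ∈ Finset.univ.filter fun b' : Fin d → Bool =>
          s * d ≤ |signVec b ⬝ᵥ signVec b'|, Real.exp (s * (s * d)) := by simp
      _ ≤ ∑ b' ∈ Finset.univ.filter fun b' : Fin d → Bool =>
          s * d ≤ |signVec b ⬝ᵥ signVec b'|, (Real.exp (s * (signVec b ⬝ᵥ signVec b')) +
            Real.exp (-s * (signVec b ⬝ᵥ signVec b'))) := by
        refine Finset.sum_le_sum fun b' hb' => ?_
        have hb'' := (Finset.mem_filter.mp hb').2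
        rcases abs_cases (signVec b ⬝ᵥ signVec b') with h | h
        · refine le_add_of_le_of_nonneg (Real.exp_le_exp.mpr ?_) (Real.exp_nonneg _)
          exact mul_le_mul_of_nonneg_left (h.1 ▸ hb'') hs
        · refine le_add_of_nonneg_of_le (Real.exp_nonneg _) (Real.exp_le_exp.mpr ?_)
          rw [neg_mul, ← mul_neg]
          exact mul_le_mul_of_nonneg_left (h.1 ▸ hb'') hs
      _ ≤ ∑ b', (Real.exp (s * (signVec b ⬝ᵥ signVec b')) +
            Real.exp (-s * (signVec b ⬝ᵥ signVec b'))) :=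
        Finset.sum_le_sum_of_subset_of_nonneg (Finset.filter_subset _ _) fun _ _ _ => by positivity
      _ = 2 * (2 * Real.cosh s) ^ d := by
        rw [Finset.sum_add_distrib, sum_exp_signVec, sum_exp_signVec, Real.cosh_neg, ← two_mul]
  have hcosh : (2 * Real.cosh s) ^ d ≤ 2 ^ d * Real.exp (s ^ 2 * d / 2) := by
    rw [mul_pow]
    refine mul_le_mul_of_nonneg_left ?_ (by positivity)
    calc Real.cosh s ^ d ≤ Real.exp (s ^ 2 / 2) ^ d :=
          pow_le_pow_left₀ (Real.cosh_pos s).le (Real.cosh_le_exp_half_sq s) d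
      _ = Real.exp (s ^ 2 * d / 2) := by rw [← Real.exp_nat_mul]; ring_nf
  have hsplit : Real.exp (-(s ^ 2 * d / 2)) * Real.exp (s * (s * d)) =
      Real.exp (s ^ 2 * d / 2) := by
    rw [← Real.exp_add]; ring_nf
  refine le_of_mul_le_mul_right ?_ (Real.exp_pos (s * (s * d)))
  calc _ ≤ _ := key
    _ ≤ 2 * (2 ^ d * Real.exp (s ^ 2 * d / 2)) := by linarith
    _ = _ := by rw [← hsplit]; ring

/-- Greedy packing under counting measure: the Chernoff bound limits what each vector excludes. `s ≤
1` makes a vector exclude itself. -/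
theorem exists_nearly_orthogonal_signs {s : ℝ} (hs : 0 < s) (hs1 : s ≤ 1) :
    ∃ Y : Finset (Fin d → Bool), Y.card = ⌈1 / 2 * Real.exp (s ^ 2 * d / 2)⌉₊ ∧
      ∀ x ∈ Y, ∀ y ∈ Y, x ≠ y → |signVec x ⬝ᵥ signVec y| < s * d := by
  obtain ⟨Y, h1, -, h2⟩ := exists_finset_pairwise (α := Fin d → Bool) Measure.count Set.univ
    (fun x y => |signVec x ⬝ᵥ signVec y| < s * d) (fun x y h => by rwa [dotProduct_comm])
    (fun x => by
      rw [signVec_dotProduct_self, not_lt, abs_of_nonneg (Nat.cast_nonneg _)]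
      exact mul_le_of_le_one_left (Nat.cast_nonneg _) hs1)
    (ENNReal.ofReal (2 * (2 ^ d * Real.exp (-(s ^ 2 * d / 2))))) (fun x _ => by
      have : {y | ¬ |signVec x ⬝ᵥ signVec y| < s * d} =
          ((Finset.univ.filter fun y : Fin d → Bool =>
            s * d ≤ |signVec x ⬝ᵥ signVec y| : Finset _) : Set (Fin d → Bool)) := by
        ext y; simp
      rw [this, Measure.count_apply_finset, ← ENNReal.ofReal_natCast]
      exact ENNReal.ofReal_le_ofReal (card_le_abs_dotProduct_le x hs.le))
    ⌈1 / 2 * Real.exp (s ^ 2 * d / 2)⌉₊ fun k hk => by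
      have hk' := Nat.lt_ceil.mp hk
      have huniv : Measure.count (Set.univ : Set (Fin d → Bool)) = ENNReal.ofReal (2 ^ d) := by
        rw [← Finset.coe_univ, Measure.count_apply_finset, Finset.card_univ, Fintype.card_fun,
          Fintype.card_bool, Fintype.card_fin, ← ENNReal.ofReal_natCast]
        push_cast
        rfl
      rw [huniv, ← ENNReal.ofReal_natCast, ← ENNReal.ofReal_mul (Nat.cast_nonneg _),
        ENNReal.ofReal_lt_ofReal_iff (by positivity)]
      calc (k : ℝ) * (2 * (2 ^ d * Real.exp (-(s ^ 2 * d / 2))))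
          < 1 / 2 * Real.exp (s ^ 2 * d / 2) * (2 * (2 ^ d * Real.exp (-(s ^ 2 * d / 2)))) :=
            mul_lt_mul_of_pos_right hk' (by positivity)
        _ = 2 ^ d * (Real.exp (s ^ 2 * d / 2) * Real.exp (-(s ^ 2 * d / 2))) := by ring
        _ = 2 ^ d := by rw [← Real.exp_add, add_neg_cancel, Real.exp_zero, mul_one]
  exact ⟨Y, h1, h2⟩

end Signs

end SCQ

namespace SCQ

/-! ### The two hard instances -/

section Instances

variable {Ω : Type*} [MeasurableSpace Ω]

theorem exists_hard_instance_two (P : Measure Ω) [IsProbabilityMeasure P]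
    (A : RandomizedAlgorithm Ω) {γ : ℝ} {d : ℕ} (hγ : 0 < γ) (hd : 48 * (1 + γ) ^ 2 ≤ (d : ℝ)) :
    ∃ (X : Finset (Fin d → ℝ)) (C : Clustering X 2),
      1 / 2 * Real.exp ((d : ℝ) / (48 * (1 + γ) ^ 2)) ≤ (X.card : ℝ) ∧
      (∀ i, (cluster C i).Nonempty) ∧ HasMargin C γ ∧
      (2 / 3 ≤ successProb P A γ C →
        ENNReal.ofReal (1 / 192 * (X.card : ℝ)) ≤ expectedQueries P A γ C) := by
  classical
  have hsq : √(1 + γ) ^ 2 = 1 + γ := Real.sq_sqrt (by linarith)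
  have hsqrt : 1 ≤ √(1 + γ) := Real.one_le_sqrt.mpr (by linarith)
  -- This `s` is the largest for which distinct `x`, `y` satisfy `√(1 + γ) * |x ⬝ᵥ y| < d = x ⬝ᵥ x`,
  -- the slab condition with normal `x`.
  obtain ⟨Y, hYcard, hY⟩ := exists_nearly_orthogonal_signs (d := d) (s := (√(1 + γ))⁻¹)
    (by positivity) (inv_le_one_of_one_le₀ hsqrt)
  rw [inv_pow, hsq] at hYcard
  set X : Finset (Fin d → ℝ) := Y.image signVec with hXdef
  have hXcard : X.card = Y.card := Finset.card_image_of_injective _ signVec_injective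
  have hexp : 1 / 2 * Real.exp ((1 + γ)⁻¹ * d / 2) ≤ X.card := by
    rw [hXcard, hYcard]; exact Nat.le_ceil _
  have hle : (d : ℝ) / (48 * (1 + γ) ^ 2) ≤ (1 + γ)⁻¹ * d / 2 := by
    rw [inv_mul_eq_div, div_div]
    refine div_le_div_of_nonneg_left (Nat.cast_nonneg _) (by positivity) ?_
    nlinarith
  have hbig : 24 ≤ (1 + γ)⁻¹ * d / 2 := by
    rw [inv_mul_eq_div, div_div, le_div_iff₀ (by positivity)]
    nlinarith
  have h3 : 3 ≤ X.card := by
    have := Real.add_one_le_exp ((1 + γ)⁻¹ * d / 2)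
    have : (3 : ℝ) ≤ X.card := by linarith
    exact_mod_cast this
  have hself : ∀ x ∈ X, x ⬝ᵥ x = d := fun x hx => by
    obtain ⟨b, -, rfl⟩ := Finset.mem_image.mp hx
    exact signVec_dotProduct_self b
  have hprod : ∀ x ∈ X, ∀ y ∈ X, x ≠ y → √(1 + γ) * |x ⬝ᵥ y| < d := fun x hx y hy hxy => by
    obtain ⟨b, hb, rfl⟩ := Finset.mem_image.mp hx
    obtain ⟨b', hb', rfl⟩ := Finset.mem_image.mp hy
    have := hY b hb b' hb' fun e => hxy (e ▸ rfl)
    rwa [inv_mul_eq_div, lt_div_iff₀ (by positivity), mul_comm] at this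
  obtain ⟨x, -, hx⟩ := exists_expectedQueries_ge P A γ (fun _ : X => (1 : Fin 2)) Finset.univ 1 0
    (by decide) (fun _ _ => rfl) (by simpa using h3)
  set C : Clustering X 2 := Function.update (fun _ => 1) x 0 with hC
  have hCx : ∀ z, C z = 0 ↔ z = x := fun z => by
    by_cases h : z = x <;> simp [hC, h]
  have hC1 : ∀ z, C z = 1 ↔ z ≠ x := fun z => by
    by_cases h : z = x <;> simp [hC, h]
  refine ⟨X, C, ?_, ?_, ?_, fun h => le_trans (ENNReal.ofReal_le_ofReal ?_) (hx h)⟩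
  · exact le_trans (by gcongr) hexp
  · obtain ⟨y, -, hy⟩ : ∃ y ∈ (Finset.univ : Finset X), y ∉ ({x} : Finset X) :=
      Finset.exists_mem_notMem_of_card_lt_card (by simp; omega)
    intro i
    fin_cases i
    · exact ⟨x, by simp [cluster, hCx]⟩
    · exact ⟨y, by simpa [cluster, hC1] using hy⟩
  · intro i
    fin_cases i
    · exact clusterHasMargin_of_subset_singleton γ x (by simp [cluster, hCx])
        (by simp [cluster, hCx])
    · refine clusterHasMargin_of_dotProduct x 0 fun y hy z hz => ?_
      simp only [cluster, Fin.mk_one, Finset.mem_filter, Finset.mem_univ, true_and, hC1,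
        not_not] at hy hz
      subst hy
      rw [sub_zero, sub_zero, hself y y.2, abs_of_nonneg (Nat.cast_nonneg (α := ℝ) d)]
      exact hprod y y.2 z z.2 fun e => hz (Subtype.ext e.symm)
  · simp only [Finset.card_univ, Fintype.card_coe]
    have : (0 : ℝ) ≤ X.card := Nat.cast_nonneg _
    linarith

/-- The lift of a point to the paraboloid over `ℝ^m`. -/
noncomputable def paraboloidLift {m : ℕ} (u : EuclideanSpace ℝ (Fin m)) : Fin (m + 1) → ℝ :=
  Matrix.vecCons (‖u‖ ^ 2) u.ofLp

theorem paraboloidLift_injective {m : ℕ} :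
    Function.Injective (paraboloidLift (m := m)) := fun _ _ h =>
  WithLp.ofLp_injective 2 (Matrix.vecCons_inj.mp h).2

/-- The normal of the tangent hyperplane at the lift of `u` turns squared distance to `u` into an
affine function; `h` shifts the slab's centre. -/
theorem tangent_dotProduct_paraboloidLift {m : ℕ} (u v : EuclideanSpace ℝ (Fin m)) (h : ℝ) :
    Matrix.vecCons 1 ((-2 : ℝ) • u.ofLp) ⬝ᵥ (paraboloidLift v - Matrix.vecCons (h - ‖u‖ ^ 2) 0) =
      ‖v - u‖ ^ 2 - h := by
  have hin : u.ofLp ⬝ᵥ v.ofLp = inner ℝ v u := by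
    simp [EuclideanSpace.inner_eq_star_dotProduct]
  rw [paraboloidLift, dotProduct_sub, Matrix.cons_dotProduct_cons, Matrix.cons_dotProduct_cons,
    smul_dotProduct, hin, dotProduct_zero, norm_sub_sq_real]
  simp only [smul_eq_mul]
  ring

theorem tangent_dotProduct_apex {m : ℕ} (u : EuclideanSpace ℝ (Fin m)) (h t : ℝ) :
    Matrix.vecCons 1 ((-2 : ℝ) • u.ofLp) ⬝ᵥ
      ((Matrix.vecCons t 0 : Fin (m + 1) → ℝ) - Matrix.vecCons (h - ‖u‖ ^ 2) 0) =
      t - h + ‖u‖ ^ 2 := by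
  rw [dotProduct_sub, Matrix.cons_dotProduct_cons, Matrix.cons_dotProduct_cons, dotProduct_zero]
  ring

theorem exists_hard_instance_three (P : Measure Ω) [IsProbabilityMeasure P]
    (A : RandomizedAlgorithm Ω) {γ : ℝ} {d : ℕ} (hγ : 0 < γ) (hγ7 : γ < 1 / 7) (hd : 2 ≤ d) :
    ∃ (X : Finset (Fin d → ℝ)) (C : Clustering X 3),
      2 * ((1 + γ) / (8 * γ)) ^ (((d : ℝ) - 1) / 2) ≤ (X.card : ℝ) ∧
      (∀ i, (cluster C i).Nonempty) ∧ HasMargin C γ ∧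
      (2 / 3 ≤ successProb P A γ C →
        ENNReal.ofReal (1 / 192 * (X.card : ℝ)) ≤ expectedQueries P A γ C) := by
  classical
  obtain ⟨m, rfl⟩ : ∃ m, d = m + 1 := ⟨d - 1, by omega⟩
  have hm : 1 ≤ m := by omega
  set a := (1 + γ) / (8 * γ) with ha
  have ha1 : 1 < a := by rw [ha, lt_div_iff₀ (by positivity)]; linarith
  have hsqa : √a ^ 2 = a := Real.sq_sqrt (by linarith)
  have hpow : a ^ (((m + 1 : ℕ) - 1 : ℝ) / 2) = √a ^ m := by
    rw [Real.sqrt_eq_rpow, ← Real.rpow_natCast, ← Real.rpow_mul (by linarith)]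
    congr 1
    push_cast
    ring
  have hsqrta : 1 < √a := Real.lt_sqrt_of_sq_lt (by linarith)
  -- Squared distances are then between `1` and `16 * a`, and `(2 * √a) ^ m ≥ 2 * √a ^ m` since `m ≥
  -- 1`.
  obtain ⟨Y, hYcard, hYR, hYsep⟩ := exists_separated_ball m (R := 2 * √a) (by positivity)
  have hYge : 2 * √a ^ m ≤ Y.card := by
    rw [hYcard]
    refine le_trans ?_ (Nat.le_ceil _)
    rw [mul_pow]
    gcongr
    exact le_self_pow₀ (by norm_num) (by omega)
  have hY3 : 3 ≤ Y.card := by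
    have h1 : 1 < √a ^ m := one_lt_pow₀ hsqrta (by omega)
    have : (2 : ℝ) < Y.card := by linarith
    exact_mod_cast this
  -- The midpoint of `[1, 16 * a]`: other points deviate from it by at most `h - 1`, the hidden one
  -- by `h`.
  set h : ℝ := 8 * a + 1 / 2 with hh
  -- High enough to be at distance at least `2 * h` from the centre of every such slab, and above
  -- all lifts.
  set p : Fin (m + 1) → ℝ := Matrix.vecCons (3 * h) 0 with hp
  have hYsq : ∀ u ∈ Y, ‖u‖ ^ 2 ≤ 4 * a := fun u hu => by
    have := pow_le_pow_left₀ (norm_nonneg u) (hYR u hu) 2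
    rw [mul_pow, hsqa] at this
    linarith
  have hpY : p ∉ Y.image paraboloidLift := fun hmem => by
    obtain ⟨u, hu, hup⟩ := Finset.mem_image.mp hmem
    have := (Matrix.vecCons_inj.mp hup).1
    linarith [hYsq u hu]
  set X : Finset (Fin (m + 1) → ℝ) := insert p (Y.image paraboloidLift) with hX
  have hXcard : X.card = Y.card + 1 := by
    rw [hX, Finset.card_insert_of_notMem hpY,
      Finset.card_image_of_injective _ paraboloidLift_injective]
  set q : X := ⟨p, Finset.mem_insert_self _ _⟩ with hq
  have hlift : ∀ z : X, z ≠ q → ∃ u ∈ Y, (z : Fin (m + 1) → ℝ) = paraboloidLift u := fun z hz => by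
    rcases Finset.mem_insert.mp z.2 with hzp | hz'
    · exact absurd (Subtype.ext hzp) hz
    · obtain ⟨u, hu, huz⟩ := Finset.mem_image.mp hz'
      exact ⟨u, hu, huz.symm⟩
  have herase : (Finset.univ.erase q : Finset X).card = Y.card := by
    rw [Finset.card_erase_of_mem (Finset.mem_univ _), Finset.card_univ, Fintype.card_coe, hXcard]
    rfl
  obtain ⟨x, hxq, hx⟩ := exists_expectedQueries_ge P A γ
    (fun z : X => if z = q then (0 : Fin 3) else 2) (Finset.univ.erase q) 2 1
    (by decide) (fun z hz => if_neg (Finset.ne_of_mem_erase hz)) (by rw [herase]; exact hY3)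
  replace hxq := Finset.ne_of_mem_erase hxq
  set C : Clustering X 3 := Function.update (fun z => if z = q then (0 : Fin 3) else 2) x 1 with hC
  have hC0 : ∀ z, C z = 0 ↔ z = q := fun z => by
    by_cases h1 : z = x
    · subst h1; simp [hC, hxq]
    · by_cases h2 : z = q <;> simp [hC, h1, h2, hxq.symm]
  have hC1 : ∀ z, C z = 1 ↔ z = x := fun z => by
    by_cases h1 : z = x
    · simp [hC, h1]
    · by_cases h2 : z = q <;> simp [hC, h1, h2, hxq.symm]
  have hC2 : ∀ z, C z = 2 ↔ z ≠ x ∧ z ≠ q := fun z => by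
    by_cases h1 : z = x
    · simp [hC, h1]
    · by_cases h2 : z = q <;> simp [hC, h1, h2, hxq.symm]
  refine ⟨X, C, ?_, ?_, ?_, fun hs => le_trans (ENNReal.ofReal_le_ofReal ?_) (hx hs)⟩
  · rw [hpow, hXcard]
    push_cast
    linarith
  · obtain ⟨y, -, hy⟩ : ∃ y ∈ (Finset.univ : Finset X), y ∉ ({x, q} : Finset X) :=
      Finset.exists_mem_notMem_of_card_lt_card
        (lt_of_le_of_lt Finset.card_le_two (by rw [Finset.card_univ, Fintype.card_coe]; omega))
    intro i
    fin_cases i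
    · exact ⟨q, by simp [cluster, hC0]⟩
    · exact ⟨x, by simp [cluster, hC1]⟩
    · exact ⟨y, by simpa [cluster, hC2] using hy⟩
  · intro i
    fin_cases i
    · exact clusterHasMargin_of_subset_singleton γ q (by simp [cluster, hC0])
        (by simp [cluster, hC0])
    · exact clusterHasMargin_of_subset_singleton γ x (by simp [cluster, hC1])
        (by simp [cluster, hC1])
    · obtain ⟨u, hu, hxu⟩ := hlift x hxq
      refine clusterHasMargin_of_dotProduct (Matrix.vecCons 1 ((-2 : ℝ) • u.ofLp))
        (Matrix.vecCons (h - ‖u‖ ^ 2) 0) fun y hy z hz => ?_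
      have hz' : z ≠ x ∧ z ≠ q := by simpa [cluster, hC2] using hz
      have hy' : y = x ∨ y = q := by
        by_contra! hcon
        exact hy (by simpa [cluster, hC2] using hcon)
      obtain ⟨v, hv, hzv⟩ := hlift z hz'.2
      have hvu : v ≠ u := fun e => hz'.1 (Subtype.ext (by rw [hzv, hxu, e]))
      have hlow : 1 ≤ ‖v - u‖ ^ 2 := one_le_pow₀ (hYsep v hv u hu hvu)
      have hupp : ‖v - u‖ ^ 2 ≤ 16 * a := by
        have := norm_sub_le v u
        have := pow_le_pow_left₀ (norm_nonneg _) (this.trans (add_le_add (hYR v hv) (hYR u hu))) 2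
        nlinarith
      have hinner : √(1 + γ) * |‖v - u‖ ^ 2 - h| < h := by
        have habs : |‖v - u‖ ^ 2 - h| ≤ h - 1 := abs_le.mpr ⟨by linarith, by linarith⟩
        -- Thus `1 + γ = 8a / (8a - 1)`, and the margin inequality reduces to a polynomial one in
        -- `a`, true for `a > 1`.
        have hγa : γ * (8 * a - 1) = 1 := by rw [ha]; field_simp; ring
        have hmain : (1 + γ) * (h - 1) ^ 2 < h ^ 2 := by
          refine lt_of_mul_lt_mul_left ?_ (show 0 ≤ 8 * a - 1 by linarith)
          have : (8 * a - 1) * ((1 + γ) * (h - 1) ^ 2) = 8 * a * (h - 1) ^ 2 := by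
            linear_combination (h - 1) ^ 2 * hγa
          rw [this, hh]
          nlinarith
        calc √(1 + γ) * |‖v - u‖ ^ 2 - h| ≤ √(1 + γ) * (h - 1) := by gcongr
          _ < h := by
            refine lt_of_pow_lt_pow_left₀ 2 (by positivity) ?_
            rwa [mul_pow, Real.sq_sqrt (by linarith)]
      rw [hzv, tangent_dotProduct_paraboloidLift]
      refine hinner.trans_le ?_
      rcases hy' with rfl | rfl
      · rw [hxu, tangent_dotProduct_paraboloidLift, sub_self, norm_zero, zero_pow two_ne_zero,
          zero_sub, abs_neg]
        exact le_abs_self h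
      · change h ≤ |_ ⬝ᵥ (Matrix.vecCons (3 * h) 0 - _)|
        rw [tangent_dotProduct_apex]
        refine le_trans ?_ (le_abs_self _)
        nlinarith [sq_nonneg ‖u‖]
  -- The apex is no candidate; `Y.card + 1 ≤ 2 * Y.card` turns `1/96` into `1/192`.
  · rw [herase, hXcard]
    have : (3 : ℝ) ≤ Y.card := by exact_mod_cast hY3
    push_cast
    linarith

end Instances

end SCQ

theorem theorem4 :
    ∃ c₁ c₂ : ℝ, 0 < c₁ ∧ 0 < c₂ ∧
      ∀ (Ω : Type*) [MeasurableSpace Ω] (P : Measure Ω) [IsProbabilityMeasure P]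
        (A : SCQ.RandomizedAlgorithm Ω),
        (∀ (γ : ℝ) (d : ℕ), 0 < γ → γ < 1 / 7 → 2 ≤ d →
          ∃ (X : Finset (Fin d → ℝ)) (C : SCQ.Clustering X 3),
            2 * ((1 + γ) / (8 * γ)) ^ (((d : ℝ) - 1) / 2) ≤ (X.card : ℝ) ∧
            (∀ i, (SCQ.cluster C i).Nonempty) ∧
            SCQ.HasMargin C γ ∧
            (2 / 3 ≤ SCQ.successProb P A γ C →
              ENNReal.ofReal (c₁ * (X.card : ℝ)) ≤ SCQ.expectedQueries P A γ C)) ∧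
        (∀ (γ : ℝ) (d : ℕ), 0 < γ → 48 * (1 + γ) ^ 2 ≤ (d : ℝ) →
          ∃ (X : Finset (Fin d → ℝ)) (C : SCQ.Clustering X 2),
            c₂ * Real.exp ((d : ℝ) / (48 * (1 + γ) ^ 2)) ≤ (X.card : ℝ) ∧
            (∀ i, (SCQ.cluster C i).Nonempty) ∧
            SCQ.HasMargin C γ ∧
            (2 / 3 ≤ SCQ.successProb P A γ C →
              ENNReal.ofReal (c₁ * (X.card : ℝ)) ≤ SCQ.expectedQueries P A γ C)) :=
  ⟨1 / 192, 1 / 2, by norm_num, by norm_num, fun _ _ P _ A =>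
    ⟨fun _ _ hγ hγ7 hd => SCQ.exists_hard_instance_three P A hγ hγ7 hd,
      fun _ _ hγ hd => SCQ.exists_hard_instance_two P A hγ hd⟩⟩
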